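/- For an infinite cardinal $\kappa$ let ${}^{\kappa>}2$ be the forcing notion of all sequences of $0$'s and $1$'s of ordinal length less than $\kappa$, ordered by end-extension (longer sequences are stronger). Products of forcing notions are full-support products, ordered coordinatewise. A forcing notion $P$ \emph{adds a generic} for a forcing notion $Q$ if there is a $P$-name $\tau$ such that every condition of $P$ forces that $\tau$ is a filter on $Q$ meeting every dense subset of $Q$ that belongs to the ground model. Let $\nu$ be a singular cardinal. Then the product $\prod_{\kappa<\nu}{}^{\kappa>}2$ over all infinite cardinals $\kappa<\nu$ adds a generic for ${}^{\nu^+>}2$; so does the product $\prod_{\kappa<\nu,\ \kappa\text{ regular}}{}^{\kappa>}2$ over all infinite regular cardinals $\kappa<\nu$. In particular, $\prod_{n<\omega}{}^{\aleph_n>}2$ adds a generic for ${}^{\aleph_{\omega+1}>}2$. -/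

import Mathlib

/-!
Forcing convention: in a forcing notion `P` (a preorder), `p ≤ q` says that `p` is the stronger
condition. The ground model is the universe of all Lean types.
-/

universe u v w

/-- The forcing notion of all `0`-`1`-sequences of (ordinal) length less than the cardinal `κ`. -/
structure CohenCond (κ : Cardinal.{u}) : Type (u + 1) where
  /-- the length of the sequence -/
  len : Ordinal.{u}
  len_lt : len < κ.ord
  /-- the entries of the sequence -/
  val : Set.Iio len → Bool

/-- `p ≤ q` (`p` is stronger) if and only if the sequence `p` extends the sequence `q`. -/
instance CohenCond.instPreorder (κ : Cardinal.{u}) : Preorder (CohenCond κ) where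
  le p q := ∃ h : q.len ≤ p.len, ∀ i : Set.Iio q.len, p.val ⟨i.1, lt_of_lt_of_le i.2 h⟩ = q.val i
  le_refl _ := ⟨le_rfl, fun _ => rfl⟩
  le_trans _ _ _ := fun ⟨h₁, e₁⟩ ⟨h₂, e₂⟩ =>
    ⟨h₂.trans h₁, fun i => (e₁ ⟨i.1, lt_of_lt_of_le i.2 h₂⟩).trans (e₂ i)⟩

namespace Forcing

variable {P : Type v} [Preorder P] {Q : Type w}

/-- A dense subset of a forcing notion. -/
def IsDenseSet {R : Type w} [Preorder R] (D : Set R) : Prop :=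
  ∀ q : R, ∃ d ∈ D, d ≤ q

/-- A sentence of the forcing language, given by the conditions that force it. -/
abbrev Sentence (P : Type v) := P → Prop

/-- A `P`-name for a subset of the ground model set `Q`: a set of pairs `(p, q)`, where `q` stands
for its canonical name. -/
abbrev SubsetName (P : Type v) (Q : Type w) := Set (P × Q)

/-- `p ⊩ q ∈ τ`: the conditions below some `t` with `(t, q) ∈ τ` are dense below `p`. -/
def mem (q : Q) (τ : SubsetName P Q) : Sentence P :=
  fun p => ∀ r ≤ p, ∃ s ≤ r, ∃ t : P, (t, q) ∈ τ ∧ s ≤ t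

/-- `p ⊩ φ ∧ ψ`. -/
def and (φ ψ : Sentence P) : Sentence P :=
  fun p => φ p ∧ ψ p

/-- `p ⊩ φ → ψ`: every condition below `p` that forces `φ` forces `ψ`. -/
def imp (φ ψ : Sentence P) : Sentence P :=
  fun p => ∀ r ≤ p, φ r → ψ r

/-- `p ⊩ ∀ x ∈ A, φ x`, where `A` is a set of the ground model. -/
def all {X : Type w} (A : Set X) (φ : X → Sentence P) : Sentence P :=
  fun p => ∀ x ∈ A, φ x p

/-- `p ⊩ ∃ x ∈ A, φ x`, where `A` is a set of the ground model: the conditions that force `φ x` for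
some `x ∈ A` are dense below `p`. -/
def ex {X : Type w} (A : Set X) (φ : X → Sentence P) : Sentence P :=
  fun p => ∀ r ≤ p, ∃ s ≤ r, ∃ x ∈ A, φ x s

/-- The sentence "`τ` is a filter on `Q`": it is nonempty, upward closed, and any two of its
elements have a common extension in it. -/
def isFilter [Preorder Q] (τ : SubsetName P Q) : Sentence P :=
  and (ex Set.univ fun q => mem q τ) <|
  and (all Set.univ fun q => all (Set.Ici q) fun q' => imp (mem q τ) (mem q' τ)) <|
  all Set.univ fun q => all Set.univ fun q' =>
    imp (and (mem q τ) (mem q' τ)) (ex (Set.Iic q ∩ Set.Iic q') fun r => mem r τ)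

/-- The sentence "`τ` is a `Q`-generic filter over the ground model": it is a filter that meets
every dense subset of `Q` that belongs to the ground model. -/
def isGeneric [Preorder Q] (τ : SubsetName P Q) : Sentence P :=
  and (isFilter τ) <|
  all {D : Set Q | IsDenseSet D} fun D => ex D fun q => mem q τ

end Forcing

/-- `P` adds a generic for `Q`: there is a `P`-name that every condition of `P` forces to be a
`Q`-generic filter over the ground model. -/
def AddsGeneric (P : Type v) [Preorder P] (Q : Type w) [Preorder Q] : Prop :=
  ∃ τ : Forcing.SubsetName P Q, ∀ p : P, Forcing.isGeneric τ p

/-! Conditions of the product are read as partial descriptions of a long sequence of conditions of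
the Cohen forcing on `ν⁺`. Keep greedily each term that extends all terms kept before. By
`addsGeneric_of_sequence` the kept terms generate a generic filter, provided that every condition
has an extension that decides all terms before some position and leaves the term there free. Proper
initial segments have at most `ν` terms, so the kept ones have a lower bound, and the free term can
enter any dense set below it.

A term is coded by a subset of `ν`, spread over blocks of bits in many coordinates. The blocks have
to lie beyond the lengths of a given condition, and these lengths form a function in a product of
regular cardinals. If `ν ≤ 2 ^ χ` for some `χ < ν`, a block of `χ` bits at coordinate `χ⁺` codes
such a function, so the generic itself chooses the positions (`addsGeneric_of_le_two_power`).
Otherwise `ν` is a strong limit, and a scale of length `ν⁺` modulo an ultrafilter supplies them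
(`exists_exact_upper_bound`, `exists_scale`); terms are then read modulo that ultrafilter. -/

namespace Forcing

/-! ### Criteria for adding a generic. -/

variable {P : Type v} [Preorder P] {Q : Type w} [Preorder Q]

/-- A coherent, monotone assignment of decided values which can be extended freely past some bound
yields a name for a generic filter. -/
theorem addsGeneric_of_decides (Dec : P → Q → Prop)
    (mono : ∀ {p p' q}, p' ≤ p → Dec p q → Dec p' q)
    (comp : ∀ {p q q'}, Dec p q → Dec p q' → q ≤ q' ∨ q' ≤ q)
    (free : ∀ p, ∃ p' ≤ p, ∃ q, ∀ q' ≤ q, ∃ p'' ≤ p', Dec p'' q') : AddsGeneric P Q := by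
  have key : ∀ q p, mem q {x : P × Q | ∃ q' ≤ x.2, Dec x.1 q'} p ↔
      ∀ r ≤ p, ∃ s ≤ r, ∃ q' ≤ q, Dec s q' := by
    intro q p
    refine forall₂_congr fun r _ => exists_congr fun s => and_congr_right fun _ => ?_
    constructor
    · rintro ⟨t, ⟨q', hq', ht⟩, hst⟩
      exact ⟨q', hq', mono hst ht⟩
    · rintro ⟨q', hq', hs⟩
      exact ⟨s, ⟨q', hq', hs⟩, le_rfl⟩
  have mem_of_dec : ∀ {q p}, Dec p q → mem q {x : P × Q | ∃ q' ≤ x.2, Dec x.1 q'} p :=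
    fun {q p} h => (key q p).2 fun r hr => ⟨r, le_rfl, q, le_rfl, mono hr h⟩
  refine ⟨{x : P × Q | ∃ q' ≤ x.2, Dec x.1 q'}, fun p => ⟨⟨?_, ?_, ?_⟩, ?_⟩⟩
  · intro r _
    obtain ⟨p', hp', q, hq⟩ := free r
    obtain ⟨p'', hp'', h⟩ := hq q le_rfl
    exact ⟨p'', hp''.trans hp', q, trivial, mem_of_dec h⟩
  · intro q _ q' hq' r _ h
    rw [key] at h ⊢
    intro s hs
    obtain ⟨t, ht, x, hx, hd⟩ := h s hs
    exact ⟨t, ht, x, hx.trans hq', hd⟩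
  · rintro q - q' - r hr ⟨h, h'⟩ s hs
    rw [key] at h h'
    obtain ⟨t, ht, x, hx, hd⟩ := h s hs
    obtain ⟨t', ht', x', hx', hd'⟩ := h' t (ht.trans hs)
    rcases comp (mono ht' hd) hd' with hxx | hxx
    · exact ⟨t', ht'.trans ht, x, ⟨hx, hxx.trans hx'⟩, mem_of_dec (mono ht' hd)⟩
    · exact ⟨t', ht'.trans ht, x', ⟨hxx.trans hx, hx'⟩, mem_of_dec hd'⟩
  · intro D hD r _
    obtain ⟨p', hp', q, hq⟩ := free r
    obtain ⟨d, hd, hdq⟩ := hD q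
    obtain ⟨p'', hp'', h⟩ := hq d hdq
    exact ⟨p'', hp''.trans hp', d, hd, mem_of_dec h⟩

/-- The position `a` of the sequence `c` of conditions is accepted if `c a` extends all conditions
at earlier accepted positions. -/
def Accepted {A : Type*} [Preorder A] [WellFoundedLT A] (c : A → Q) : A → Prop :=
  wellFounded_lt.fix fun a acc => ∀ b (h : b < a), acc b h → c a ≤ c b

section Accepted

variable {A : Type*} [LinearOrder A] [WellFoundedLT A]

theorem accepted_iff (c : A → Q) (a : A) :
    Accepted c a ↔ ∀ b < a, Accepted c b → c a ≤ c b := by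
  rw [Accepted, WellFounded.fix_eq]

theorem accepted_congr {c c' : A → Q} {a : A} (h : ∀ b ≤ a, c b = c' b) :
    Accepted c a ↔ Accepted c' a := by
  induction a using WellFoundedLT.induction with
  | ind a ih =>
    rw [accepted_iff, accepted_iff]
    refine forall₂_congr fun b hb => ?_
    rw [ih b hb fun x hx => h x (hx.trans hb.le), h a le_rfl, h b hb.le]

theorem Accepted.le_or_le {c : A → Q} {a b : A} (ha : Accepted c a) (hb : Accepted c b) :
    c a ≤ c b ∨ c b ≤ c a := by
  rcases lt_trichotomy a b with h | rfl | h
  · exact .inr ((accepted_iff c b).1 hb a h ha)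
  · exact .inl le_rfl
  · exact .inl ((accepted_iff c a).1 ha b h hb)

/-- If the conditions of `P` decide the initial segments of a sequence of conditions of `Q`, and
every next term of the sequence is free, then `P` adds a generic for `Q`. -/
theorem addsGeneric_of_sequence (decided : P → Set A) (c : P → A → Q)
    (lower : ∀ p, IsLowerSet (decided p))
    (mono : ∀ {p p'}, p' ≤ p → decided p ⊆ decided p')
    (stable : ∀ {p p' a}, p' ≤ p → a ∈ decided p → c p' a = c p a)
    (chain : ∀ (a : A) (s : Set A) (f : A → Q), s ⊆ Set.Iio a →
      (∀ x ∈ s, ∀ y ∈ s, f x ≤ f y ∨ f y ≤ f x) → ∃ q, ∀ x ∈ s, q ≤ f x)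
    (free : ∀ p, ∃ p' ≤ p, ∃ a, Set.Iio a ⊆ decided p' ∧
      ∀ x, ∃ p'' ≤ p', a ∈ decided p'' ∧ c p'' a = x) : AddsGeneric P Q := by
  have stable' : ∀ {p p' a}, p' ≤ p → a ∈ decided p → ∀ b ≤ a, c p' b = c p b :=
    fun h ha b hb => stable h (lower _ hb ha)
  refine addsGeneric_of_decides (fun p q => ∃ a ∈ decided p, Accepted (c p) a ∧ c p a = q) ?_ ?_ ?_
  · rintro p p' q h ⟨a, ha, hacc, rfl⟩
    exact ⟨a, mono h ha, (accepted_congr (stable' h ha)).2 hacc, stable h ha⟩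
  · rintro p q q' ⟨a, ha, hacc, rfl⟩ ⟨b, hb, hbcc, rfl⟩
    exact hacc.le_or_le hbcc
  · intro p
    obtain ⟨p', hp', a, ha, hx⟩ := free p
    obtain ⟨q, hq⟩ := chain a {b | b < a ∧ Accepted (c p') b} (c p') (fun b hb => hb.1)
      fun x hx y hy => hx.2.le_or_le hy.2
    refine ⟨p', hp', q, fun q' hq' => ?_⟩
    obtain ⟨p'', hp'', hd, rfl⟩ := hx q'
    refine ⟨p'', hp'', a, hd, (accepted_iff _ a).2 fun b hb hacc => ?_, rfl⟩
    rw [stable hp'' (ha hb)]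
    exact hq'.trans (hq b ⟨hb, (accepted_congr (stable' hp'' (ha hb))).1 hacc⟩)

end Accepted

end Forcing

/-! ### Cohen conditions as bit sequences. -/

/-- Few ordinals below a regular cardinal are bounded. -/
theorem Cardinal.IsRegular.exists_bound {κ : Cardinal.{u}} (hκ : κ.IsRegular) {T : Type w}
    (hT : Cardinal.lift.{u} (Cardinal.mk T) < Cardinal.lift.{w} κ) (f : T → Ordinal.{u})
    (hf : ∀ t, f t < κ.ord) : ∃ o < κ.ord, ∀ t, f t < o := by
  have : Small.{u} T := HasCardinalLT.small hT
  refine ⟨⨆ t, f t + 1, ?_, fun t => Ordinal.lt_iSup_add_one _ t⟩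
  refine Ordinal.lift_iSup_add_one_lt_of_lt_cof ?_ hf
  rwa [← Ordinal.lift_cof, hκ.cof_ord]

namespace CohenCond

variable {κ : Cardinal.{u}}

/-- The entry of `p` at the position `j`, `false` beyond its length. -/
noncomputable def bit (p : CohenCond κ) (j : Ordinal.{u}) : Bool :=
  open Classical in if h : j < p.len then p.val ⟨j, h⟩ else false

theorem le_iff {p q : CohenCond κ} :
    p ≤ q ↔ q.len ≤ p.len ∧ ∀ j < q.len, p.bit j = q.bit j := by
  constructor
  · rintro ⟨h, e⟩
    refine ⟨h, fun j hj => ?_⟩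
    rw [bit, bit, dif_pos hj, dif_pos (hj.trans_le h)]
    exact e ⟨j, hj⟩
  · rintro ⟨h, e⟩
    refine ⟨h, fun ⟨j, hj⟩ => ?_⟩
    have := e j hj
    rw [Set.mem_Iio] at hj
    rwa [bit, bit, dif_pos hj, dif_pos (lt_of_lt_of_le hj h)] at this

theorem exists_bit_eq (L : Ordinal.{u}) (hL : L < κ.ord) (x : Ordinal.{u} → Bool) :
    ∃ p : CohenCond κ, p.len = L ∧ ∀ j < L, p.bit j = x j :=
  ⟨⟨L, hL, fun i => x i⟩, rfl, fun _ hj => dif_pos hj⟩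

theorem exists_extension (p : CohenCond κ) (L : Ordinal.{u}) (hL : L < κ.ord)
    (x : Ordinal.{u} → Bool) :
    ∃ p' ≤ p, p'.len = max p.len L ∧ ∀ j, p.len ≤ j → j < L → p'.bit j = x j := by
  classical
  obtain ⟨p', h, e⟩ := exists_bit_eq (max p.len L) (max_lt p.len_lt hL)
    (fun j => if j < p.len then p.bit j else x j)
  refine ⟨p', le_iff.2 ⟨h ▸ le_max_left _ _, fun j hj => ?_⟩, h, fun j hj hj' => ?_⟩
  · rw [e j (lt_max_of_lt_left hj), if_pos hj]
  · rw [e j (lt_max_of_lt_right hj'), if_neg hj.not_gt]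

/-- The union of the chain works: regularity bounds its length, and comparability makes each bit
independent of the member it is taken from. -/
theorem exists_lower_bound (hκ : κ.IsRegular) {T : Type w}
    (hT : Cardinal.lift.{u} (Cardinal.mk T) < Cardinal.lift.{w} κ) (f : T → CohenCond κ)
    (hf : ∀ s t, f s ≤ f t ∨ f t ≤ f s) : ∃ q, ∀ t, q ≤ f t := by
  classical
  obtain ⟨o, ho, h⟩ := hκ.exists_bound hT (fun t => (f t).len) fun t => (f t).len_lt
  obtain ⟨q, hq, e⟩ := exists_bit_eq o ho
    (fun j => if h : ∃ t, j < (f t).len then (f h.choose).bit j else false)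
  refine ⟨q, fun t => le_iff.2 ⟨hq ▸ (h t).le, fun j hj => ?_⟩⟩
  have hex : ∃ t, j < (f t).len := ⟨t, hj⟩
  rw [e j (hj.trans (h t)), dif_pos hex]
  rcases hf hex.choose t with hle | hle
  · exact (le_iff.1 hle).2 j hj
  · exact ((le_iff.1 hle).2 j hex.choose_spec).symm

instance : Inhabited (CohenCond (Order.succ κ)) :=
  ⟨⟨0, by simp [Cardinal.lt_ord], fun _ => false⟩⟩

end CohenCond

/-! ### Coding and reading objects in blocks of bits. -/

open Cardinal in
/-- A set of size at most `2 ^ χ` is coded by sets of ordinals below `χ`. -/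
theorem Cardinal.exists_code {χ : Cardinal.{u}} {X : Type (u + 1)}
    (hX : #X ≤ lift.{u + 1} (2 ^ χ)) :
    ∃ e : X → Set Ordinal.{u}, ∀ x y, (∀ j < χ.ord, j ∈ e x ↔ j ∈ e y) → x = y := by
  have hs : #(Set (Set.Iio χ.ord)) = lift.{u + 1} (2 ^ χ) := by
    simp [mk_Iio_ordinal]
  rw [← hs] at hX
  obtain ⟨f⟩ := (le_def _ _).1 hX
  refine ⟨fun p => Subtype.val '' f p, fun x y h => f.injective (Set.ext fun j => ?_)⟩
  simpa [show (j : Ordinal) < χ.ord from j.2] using h j j.2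

open Cardinal in
theorem CohenCond.mk_le {ν : Cardinal.{u}} (hν : ℵ₀ ≤ ν) :
    #(CohenCond (Order.succ ν)) ≤ lift.{u + 1} (2 ^ ν) := by
  have hinj : Function.Injective (fun p : CohenCond (Order.succ ν) =>
      (⟨⟨p.len, p.len_lt⟩, p.val⟩ :
        Σ o : Set.Iio (Order.succ ν).ord, Set.Iio o.1 → Bool)) := by
    rintro ⟨a, ha, f⟩ ⟨b, hb, g⟩ h
    obtain ⟨h₁, h⟩ := Sigma.mk.inj h
    obtain rfl := congrArg Subtype.val h₁
    simpa using h
  refine (mk_le_of_injective hinj).trans ?_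
  rw [mk_sigma]
  refine (sum_le_mk_mul_iSup _).trans ?_
  have h : #(Set.Iio (Order.succ ν).ord) ≤ lift.{u + 1} (2 ^ ν) := by
    rw [mk_Iio_ordinal, card_ord, lift_le]
    exact Order.succ_le_of_lt (cantor ν)
  refine (mul_le_mul' h (ciSup_le' fun o => ?_)).trans (mul_eq_self ?_).le
  · have : (#(Set.Iio o.1 → Bool)) = lift.{u + 1} (2 ^ o.1.card) := by
      simp [mk_Iio_ordinal]
    rw [this, lift_le]
    refine power_le_power_left two_ne_zero ?_
    exact Order.lt_succ_iff.1 (lt_ord.1 o.2)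
  · rw [aleph0_le_lift]
    exact hν.trans (cantor ν).le

section Reading

variable {I : Type v} {K : I → Cardinal.{u}} {J : Type w} {X : Type*}

/-- The blocks of length `b r` at the positions `f r` of the sequences `p (idx r)` code `x`, for
`l`-almost all `r`. -/
def Codes (l : Filter J) (idx : J → I) (e : X → Set Ordinal.{u}) (b f : J → Ordinal.{u})
    (p : ∀ i, CohenCond (K i)) (x : X) : Prop :=
  ∀ᶠ r in l, ∀ j < b r, (p (idx r)).bit (f r + j) = true ↔ j ∈ e x

/-- The object coded by the blocks at the positions `f`. -/
noncomputable def readCode [Nonempty X] (l : Filter J) (idx : J → I) (e : X → Set Ordinal.{u})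
    (b f : J → Ordinal.{u}) (p : ∀ i, CohenCond (K i)) : X :=
  Classical.epsilon (Codes l idx e b f p)

/-- The blocks of length `b r` at the positions `f r` are contained in the sequences `p (idx r)`. -/
def Full (l : Filter J) (idx : J → I) (b f : J → Ordinal.{u}) (p : ∀ i, CohenCond (K i)) : Prop :=
  ∀ᶠ r in l, f r + b r ≤ (p (idx r)).len

variable {l : Filter J} {idx : J → I} {e : X → Set Ordinal.{u}} {b f : J → Ordinal.{u}}
  {p p' : ∀ i, CohenCond (K i)}

theorem Full.mono (h : Full l idx b f p) (hp : p' ≤ p) : Full l idx b f p' :=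
  Filter.Eventually.mono h fun r hr => hr.trans (CohenCond.le_iff.1 (hp (idx r))).1

/-- `p` and `p'` agree on almost all blocks, so `epsilon` is applied to the same predicate, even if
nothing is coded. -/
theorem Full.readCode_eq [Nonempty X] (h : Full l idx b f p) (hp : p' ≤ p) :
    readCode l idx e b f p' = readCode l idx e b f p := by
  have : Codes l idx e b f p' = Codes l idx e b f p := by
    funext x
    refine propext (Filter.eventually_congr (Filter.Eventually.mono h fun r hr => ?_))
    refine forall₂_congr fun j hj => ?_
    rw [(CohenCond.le_iff.1 (hp (idx r))).2 _ (lt_of_lt_of_le (by gcongr) hr)]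
  rw [readCode, this, readCode]

/-- Any two coded objects agree at each `j < c`, since some block that codes both is longer than
`j`. -/
theorem Codes.readCode_eq [Nonempty X] {x : X} (h : Codes l idx e b f p x) {c : Ordinal.{u}}
    (he : ∀ x y, (∀ j < c, j ∈ e x ↔ j ∈ e y) → x = y) (hb : ∀ j < c, ∃ᶠ r in l, j < b r) :
    readCode l idx e b f p = x := by
  have h' : Codes l idx e b f p (readCode l idx e b f p) := Classical.epsilon_spec ⟨x, h⟩
  refine he _ _ fun j hj => ?_
  obtain ⟨r, hr, h₁, h₂⟩ := ((hb j hj).and_eventually (h.and h')).exists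
  rw [← h₁ j hr, ← h₂ j hr]

theorem exists_extension_pi (hidx : Function.Injective idx) (p : ∀ i, CohenCond (K i))
    (L : J → Ordinal.{u}) (hL : ∀ r, L r < (K (idx r)).ord) (x : J → Ordinal.{u} → Bool) :
    ∃ p' ≤ p, (∀ r, (p' (idx r)).len = max (p (idx r)).len (L r)) ∧
      (∀ r j, (p (idx r)).len ≤ j → j < L r → (p' (idx r)).bit j = x r j) ∧
      ∀ i, i ∉ Set.range idx → p' i = p i := by
  have : ∀ i, ∃ q ≤ p i, (∀ r, idx r = i → q.len = max (p i).len (L r) ∧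
      ∀ j, (p i).len ≤ j → j < L r → q.bit j = x r j) ∧ (i ∉ Set.range idx → q = p i) := by
    intro i
    by_cases h : i ∈ Set.range idx
    · obtain ⟨r, rfl⟩ := h
      obtain ⟨q, hq, h₁, h₂⟩ := (p (idx r)).exists_extension (L r) (hL r) (x r)
      refine ⟨q, hq, fun s hs => ?_, fun h => (h ⟨r, rfl⟩).elim⟩
      obtain rfl := hidx hs
      exact ⟨h₁, h₂⟩
    · exact ⟨p i, le_rfl, fun r hr => (h ⟨r, hr⟩).elim, fun _ => rfl⟩
  choose p' hp' h₁ h₂ using this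
  exact ⟨p', hp', fun r => (h₁ _ r rfl).1, fun r => (h₁ _ r rfl).2, h₂⟩

/-- Beyond the lengths of the sequences, the blocks are free to code any object. -/
theorem exists_codes (hidx : Function.Injective idx) (p : ∀ i, CohenCond (K i))
    (hL : ∀ r, f r + b r < (K (idx r)).ord) (hf : ∀ᶠ r in l, (p (idx r)).len ≤ f r) (x : X) :
    ∃ p' ≤ p, Full l idx b f p' ∧ Codes l idx e b f p' x ∧
      ∀ i, i ∉ Set.range idx → p' i = p i := by
  classical
  obtain ⟨p', hp', h₁, h₂, h₃⟩ := exists_extension_pi hidx p (fun r => f r + b r) hL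
    fun r j => decide (j - f r ∈ e x)
  refine ⟨p', hp', .of_forall fun r => h₁ r ▸ le_max_right _ _, ?_, h₃⟩
  refine hf.mono fun r hr j hj => ?_
  rw [h₂ r _ (hr.trans le_self_add) (by gcongr)]
  simp

end Reading

/-! ### The case `ν ≤ 2 ^ χ` with `χ < ν`. -/

open Cardinal

theorem CohenCond.chain {ν : Cardinal.{u}} (hν : ℵ₀ ≤ ν) {A : Type w} [LinearOrder A]
    (hA : ∀ a : A, lift.{u} #(Set.Iio a) ≤ lift.{w} ν) (a : A) (s : Set A)
    (f : A → CohenCond (Order.succ ν)) (hs : s ⊆ Set.Iio a)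
    (hf : ∀ x ∈ s, ∀ y ∈ s, f x ≤ f y ∨ f y ≤ f x) : ∃ q, ∀ x ∈ s, q ≤ f x := by
  obtain ⟨q, hq⟩ := CohenCond.exists_lower_bound (isRegular_succ hν) (T := s)
    (((lift_le.2 (mk_le_mk_of_subset hs)).trans (hA a)).trans_lt (lift_lt.2 (Order.lt_succ ν)))
    (fun x => f x) fun x y => hf x x.2 y y.2
  exact ⟨q, fun x hx => hq ⟨x, hx⟩⟩

theorem Cardinal.mk_Iio_coe_le {χ : Cardinal.{u}} (a : Set.Iio (Order.succ χ).ord) :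
    #(Set.Iio a) ≤ lift.{u + 1} χ := by
  refine (mk_le_of_injective (β := Set.Iio a.1) (f := fun x => ⟨x.1.1, x.2⟩)
    fun x y h => ?_).trans ?_
  · simpa [Subtype.ext_iff] using h
  · rw [mk_Iio_ordinal, lift_le]
    exact Order.lt_succ_iff.1 (lt_ord.1 a.2)

/-- Since `(2 ^ χ) ^ χ = 2 ^ χ`, a whole vector of reading positions fits into `χ` bits. -/
theorem Cardinal.mk_pi_Iio_le {χ ν : Cardinal.{u}} (hχ : ℵ₀ ≤ χ) {ι : Type u} (hι : #ι ≤ χ)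
    (hν : ν ≤ 2 ^ χ) (f : ι → Ordinal.{u}) (hf : ∀ i, (f i).card ≤ ν) :
    #(∀ i, Set.Iio (f i)) ≤ lift.{u + 1} (2 ^ χ) := by
  rw [mk_pi]
  have : ∀ i, #(Set.Iio (f i)) ≤ lift.{u + 1} (2 ^ χ) := fun i => by
    rw [mk_Iio_ordinal, lift_le]
    exact (hf i).trans hν
  refine (prod_le_prod _ _ this).trans ?_
  rw [prod_const, lift_lift, ← lift_power, lift_le, ← power_mul]
  exact power_le_power_left two_ne_zero (mul_le_of_le hχ le_rfl hι)

/-- If `ν ≤ 2 ^ χ` for some `χ < ν`, then the sequence at the coordinate `χ⁺` chooses the positions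
at which the sequences at the other coordinates are read. -/
theorem addsGeneric_of_le_two_power {ν χ : Cardinal.{u}} {I : Type v} {K : I → Cardinal.{u}}
    (hχ : ℵ₀ ≤ χ) (hχν : χ < ν) (h2 : ν ≤ 2 ^ χ) {i₀ : I} (hi₀ : K i₀ = Order.succ χ)
    {ι : Type u} (hι : #ι ≤ χ) {N : ι → Cardinal.{u}} (hN : ∀ i, χ < N i) (hNν : ∀ i, N i < ν)
    (hcof : ∀ c < ν, ∃ i, c < N i) {idx : ι → I} (inj : Function.Injective idx)
    (hidx : ∀ i, K (idx i) = Order.succ (N i)) :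
    AddsGeneric (∀ i, CohenCond (K i)) (CohenCond (Order.succ ν)) := by
  have hν : ℵ₀ ≤ ν := hχ.trans hχν.le
  obtain ⟨e, he⟩ := exists_code (CohenCond.mk_le hν)
  obtain ⟨d, hd⟩ := exists_code (mk_pi_Iio_le hχ hι h2 (fun i => (Order.succ (N i)).ord)
    fun i => by simpa using Order.succ_le_of_lt (hNν i))
  have hNinf : ∀ i, ℵ₀ ≤ N i := fun i => hχ.trans (hN i).le
  have : Nonempty (∀ i, Set.Iio (Order.succ (N i)).ord) :=
    ⟨fun i => ⟨0, by simp [lt_ord]⟩⟩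
  have hi₀' : i₀ ∉ Set.range idx := by
    rintro ⟨i, rfl⟩
    exact (hN i).ne' (Order.succ_injective ((hidx i).symm.trans hi₀))
  have inj₀ : Function.Injective (fun _ : Unit => i₀) := fun _ _ _ => rfl
  -- With the filter `⊤`, "eventually" means at every index and "frequently" means at some index.
  have hb : ∀ j < ν.ord, ∃ᶠ i in (⊤ : Filter ι), j < (N i).ord := fun j hj => by
    obtain ⟨i, hi⟩ := hcof j.card (lt_ord.1 hj)
    exact Filter.frequently_top.2 ⟨i, lt_ord.2 hi⟩
  have hb₀ : ∀ j < χ.ord, ∃ᶠ _ in (⊤ : Filter Unit), j < χ.ord := fun j hj =>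
    Filter.frequently_top.2 ⟨(), hj⟩
  have hmul : ∀ {a}, a < (Order.succ χ).ord → χ.ord * a < (Order.succ χ).ord := fun ha =>
    Ordinal.isPrincipal_mul_ord (hχ.trans (Order.le_succ χ)) (ord_lt_ord.2 (Order.lt_succ χ)) ha
  have hadd : ∀ {a}, a < (Order.succ χ).ord → a + χ.ord < (Order.succ χ).ord := fun ha =>
    Ordinal.isPrincipal_add_ord (hχ.trans (Order.le_succ χ)) ha (ord_lt_ord.2 (Order.lt_succ χ))
  -- `F γ` says that the pointer block `γ` at `i₀` is complete; `G p γ` is the vector of positions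
  -- it codes.
  let F : Set.Iio (Order.succ χ).ord → (∀ i, CohenCond (K i)) → Prop := fun γ =>
    Full ⊤ (fun _ : Unit => i₀) (fun _ => χ.ord) (fun _ => χ.ord * γ)
  let G : (∀ i, CohenCond (K i)) → Set.Iio (Order.succ χ).ord →
      ∀ i, Set.Iio (Order.succ (N i)).ord :=
    fun p γ => readCode ⊤ (fun _ : Unit => i₀) d (fun _ => χ.ord) (fun _ => χ.ord * γ) p
  have hG : ∀ {p p' γ}, F γ p → p' ≤ p → G p' γ = G p γ := fun h h' => h.readCode_eq h'
  refine Forcing.addsGeneric_of_sequence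
    (decided := fun p => {β | ∀ γ ≤ β, F γ p ∧
      Full ⊤ idx (fun i => (N i).ord) (fun i => G p γ i) p})
    (c := fun p β => readCode ⊤ idx e (fun i => (N i).ord) (fun i => G p β i) p)
    (fun p a b hba ha γ hγ => ha γ (hγ.trans hba)) ?_ ?_ (CohenCond.chain hν ?_) ?_
  · intro p p' hp β hβ γ hγ
    refine ⟨(hβ γ hγ).1.mono hp, ?_⟩
    rw [hG (hβ γ hγ).1 hp]
    exact (hβ γ hγ).2.mono hp
  · intro p p' β hp hβ
    simp only [hG (hβ β le_rfl).1 hp]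
    exact (hβ β le_rfl).2.readCode_eq hp
  · intro a
    have := lift_le.{u}.2 ((mk_Iio_coe_le a).trans (lift_le.2 hχν.le))
    simpa using this
  · intro p
    have hα : (p i₀).len < (Order.succ χ).ord := hi₀ ▸ (p i₀).len_lt
    -- As `(p i₀).len ≤ χ.ord * α`, padding to that length completes the pointer blocks before `α`
    -- and leaves block `α` untouched.
    set α : Set.Iio (Order.succ χ).ord := ⟨(p i₀).len, hα⟩
    obtain ⟨p₁, hp₁, hlen₁, -, -⟩ := exists_extension_pi inj₀ p (fun _ => χ.ord * α)
      (fun _ => by rw [hi₀]; exact hmul hα) (fun _ _ => false)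
    have hlen₁ : (p₁ i₀).len = χ.ord * α := by
      rw [hlen₁ ()]
      exact max_eq_right (Ordinal.le_mul_right _ (by simpa using aleph0_pos.trans_le hχ))
    have hF₁ : ∀ γ < α, F γ p₁ := fun γ hγ => .of_forall fun _ => by
      change χ.ord * γ + χ.ord ≤ (p₁ i₀).len
      rw [hlen₁, ← mul_add_one]
      gcongr
      exact Order.add_one_le_of_lt hγ
    -- There are at most `χ < N i` earlier pointers, so the blocks they select are bounded below the
    -- regular `(N i)⁺`.
    have hbound : ∀ i, ∃ L < (Order.succ (N i)).ord, ∀ γ : Set.Iio α,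
        (G p₁ γ i : Ordinal) + (N i).ord < L := fun i =>
      (isRegular_succ (hNinf i)).exists_bound ((lift_le.{u}.2 (mk_Iio_coe_le α)).trans_lt
        (by simpa using (hN i).trans (Order.lt_succ _))) _ fun γ =>
        Ordinal.isPrincipal_add_ord ((hNinf i).trans (Order.le_succ _)) (G p₁ γ i).2
          (ord_lt_ord.2 (Order.lt_succ _))
    choose L hL hLG using hbound
    obtain ⟨p₂, hp₂, hlen₂, -, hoff₂⟩ := exists_extension_pi inj p₁ L
      (fun i => by rw [hidx]; exact hL i) (fun _ _ => false)
    have hdec₂ : Set.Iio α ⊆ {β | ∀ γ ≤ β, F γ p₂ ∧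
        Full ⊤ idx (fun i => (N i).ord) (fun i => G p₂ γ i) p₂} := fun β hβ γ hγ => by
      have hγα : γ < α := lt_of_le_of_lt hγ hβ
      refine ⟨(hF₁ γ hγα).mono hp₂, .of_forall fun i => ?_⟩
      rw [hG (hF₁ γ hγα) hp₂, hlen₂]
      exact le_max_of_le_right (hLG i ⟨γ, hγα⟩).le
    refine ⟨p₂, hp₂.trans hp₁, α, hdec₂, fun x => ?_⟩
    -- Pointer block `α` will select the current ends of the sequences, where nothing is written
    -- yet.
    let g : ∀ i, Set.Iio (Order.succ (N i)).ord := fun i =>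
      ⟨(p₂ (idx i)).len, by rw [Set.mem_Iio, ← hidx]; exact (p₂ (idx i)).len_lt⟩
    obtain ⟨p₃, hp₃, hF₃, hC₃, hoff₃⟩ := exists_codes (l := ⊤) (e := d) (b := fun _ => χ.ord)
      (f := fun _ => χ.ord * α) inj₀ p₂ (fun _ => by rw [hi₀]; exact hadd (hmul hα))
      (.of_forall fun _ => by rw [hoff₂ _ hi₀', hlen₁]) g
    have hG₃ : G p₃ α = g := hC₃.readCode_eq hd hb₀
    have hg : ∀ i, (p₃ (idx i)).len = g i := fun i => by
      rw [hoff₃ _ (by rintro ⟨_, h⟩; exact hi₀' ⟨i, h.symm⟩)]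
    obtain ⟨p₄, hp₄, hF₄, hC₄, -⟩ := exists_codes (l := ⊤) (e := e) (b := fun i => (N i).ord)
      (f := fun i => g i) inj p₃ (fun i => by
        rw [hidx]
        exact Ordinal.isPrincipal_add_ord ((hNinf i).trans (Order.le_succ _)) (g i).2
          (ord_lt_ord.2 (Order.lt_succ _)))
      (.of_forall fun i => (hg i).le) x
    have hG₄ : G p₄ α = g := (hG hF₃ hp₄).trans hG₃
    refine ⟨p₄, hp₄.trans hp₃, fun γ hγ => ?_, ?_⟩
    · rcases hγ.lt_or_eq with hγ | rfl
      · obtain ⟨h₁, h₂⟩ := hdec₂ hγ γ le_rfl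
        refine ⟨h₁.mono (hp₄.trans hp₃), ?_⟩
        rw [hG h₁ (hp₄.trans hp₃)]
        exact h₂.mono (hp₄.trans hp₃)
      · exact ⟨hF₃.mono hp₄, hG₄ ▸ hF₄⟩
    · simp only [hG₄]
      exact hC₄.readCode_eq he hb

/-! ### Scales modulo an ultrafilter. -/

theorem WellFoundedLT.exists_rec {W : Type v} [LT W] [WellFoundedLT W] {X : Type w}
    (Φ : ∀ a : W, ({b // b < a} → X) → X → Prop) (h : ∀ a g, ∃ y, Φ a g y) :
    ∃ F : W → X, ∀ a, Φ a (fun b => F b) (F a) := by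
  choose y hy using h
  refine ⟨wellFounded_lt.fix fun a g => y a fun b => g b b.2, fun a => ?_⟩
  rw [WellFounded.fix_eq]
  exact hy a _

section Scale

variable {Λ : Type u} [LinearOrder Λ] {ι : Type u} {D : Ultrafilter ι} {ν θ : Cardinal.{u}}

/-- Otherwise every fiber is bounded, and a common strict bound lies in no fiber. -/
theorem exists_cofinal_fiber (hΛ : ∀ {T : Type u} (t : T → Λ), #T ≤ ν → ∃ a, ∀ x, t x < a)
    {Y : Type u} (hY : #Y ≤ ν) (k : Λ → Y) : ∃ y, ∀ a, ∃ b, a ≤ b ∧ k b = y := by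
  by_contra! h
  choose t ht using h
  obtain ⟨a, ha⟩ := hΛ t hY
  exact ht (k a) a (ha _).le rfl

/-- The index `t` for which `k t i` is the least value which is at least `x`. -/
theorem exists_least_cover {T : Type u} (k : T → ι → Ordinal.{u}) (t₀ : T) (x : ι → Ordinal.{u})
    (h₀ : ∀ i, x i ≤ k t₀ i) :
    ∃ τ : ι → T, ∀ i, x i ≤ k (τ i) i ∧ ∀ t, x i ≤ k t i → k (τ i) i ≤ k t i := by
  have : ∀ i, ∃ τ : T, x i ≤ k τ i ∧ ∀ t, x i ≤ k t i → k τ i ≤ k t i := by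
    intro i
    obtain ⟨τ, hτ, hmin⟩ := (InvImage.wf (fun t => k t i) wellFounded_lt).has_min
      {t | x i ≤ k t i} ⟨t₀, h₀ i⟩
    exact ⟨τ, hτ, fun t ht => not_lt.1 (hmin t ht)⟩
  choose τ hτ using this
  exact ⟨τ, hτ⟩

/-- An increasing sequence of functions modulo an ultrafilter has a least upper bound if it is
longer than the number of subsets of the index set. -/
theorem exists_least_upper_bound
    (hΛ : ∀ {T : Type u} (t : T → Λ), #T ≤ ν → ∃ a, ∀ x, t x < a)
    (hθ : ℵ₀ ≤ θ) (hι : #ι ≤ θ) (h2 : 2 ^ θ ≤ ν) (f : Λ → ι → Ordinal.{u})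
    (hf : ∀ a b, a ≤ b → ∀ᶠ i in D, f a i ≤ f b i) (u₀ : ι → Ordinal.{u})
    (hu₀ : ∀ a i, f a i ≤ u₀ i) :
    ∃ h : ι → Ordinal.{u}, (∀ a, ∀ᶠ i in D, f a i ≤ h i) ∧
      ∀ y : ι → Ordinal.{u}, (∀ a, ∀ᶠ i in D, f a i ≤ y i) → ∀ᶠ i in D, h i ≤ y i := by
  classical
  by_contra! H
  -- There are `θ⁺` stages: more than `#ι`, for the final pigeonhole, but at most `2 ^ θ ≤ ν`, so
  -- the `a₀ ζ` have a common bound.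
  let W := (Order.succ θ).ord.ToType
  have hW : #W = Order.succ θ := by simp [W]
  let k : ∀ ζ : W, ({ξ // ξ < ζ} → ι → Ordinal.{u}) → Option {ξ // ξ < ζ} → ι → Ordinal.{u} :=
    fun ζ g o => o.elim u₀ g
  have cov : ∀ ζ g a, ∃ τ : ι → Option {ξ // ξ < ζ}, ∀ i, f a i ≤ k ζ g (τ i) i ∧
      ∀ t, f a i ≤ k ζ g t i → k ζ g (τ i) i ≤ k ζ g t i := fun ζ g a =>
    exists_least_cover (k ζ g) none (f a) (hu₀ a)
  choose τ hτ hτmin using cov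
  -- There are at most `2 ^ θ` cover functions, so one of them, `σ`, recurs cofinally. Its cover is
  -- an upper bound and is not least, which yields `y`.
  have step : ∀ ζ g, ∃ y : ι → Ordinal.{u}, (∀ a, ∀ᶠ i in D, f a i ≤ y i) ∧
      ∃ a₀, ∀ a, a₀ ≤ a → ∀ᶠ i in D, y i < k ζ g (τ ζ g a i) i := by
    intro ζ g
    have hT : #(ι → Option {ξ // ξ < ζ}) ≤ ν := by
      have h1 : #{ξ // ξ < ζ} ≤ θ := by
        have : #(Set.Iio ζ) < #W := mk_Iio_lt ζ (by simp [W])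
        rw [hW] at this
        exact Order.lt_succ_iff.1 this
      have h3 : #(Option {ξ // ξ < ζ}) ≤ θ := by
        rw [mk_option]
        exact add_le_of_le hθ h1 (one_le_aleph0.trans hθ)
      rw [← power_def]
      refine (power_le_power_right (h3.trans (cantor θ).le)).trans ?_
      rw [← power_mul]
      exact (power_le_power_left two_ne_zero (mul_le_of_le hθ le_rfl hι)).trans h2
    obtain ⟨σ, hσ⟩ := exists_cofinal_fiber hΛ hT (τ ζ g)
    have hmono : ∀ a b, a ≤ b → ∀ᶠ i in D, k ζ g (τ ζ g a i) i ≤ k ζ g (τ ζ g b i) i :=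
      fun a b hab => (hf a b hab).mono fun i hi =>
        hτmin ζ g a i _ (hi.trans (hτ ζ g b i))
    obtain ⟨y, hy, hlt⟩ := H (fun i => k ζ g (σ i) i) fun a => by
      obtain ⟨b, hab, rfl⟩ := hσ a
      exact (hmono a b hab).mono fun i hi => (hτ ζ g a i).trans hi
    obtain ⟨a₀, -⟩ := hΛ (T := PEmpty) (fun x => x.elim) (by simp)
    obtain ⟨b, -, rfl⟩ := hσ a₀
    refine ⟨y, hy, b, fun a ha => ?_⟩
    filter_upwards [hlt, hmono b a ha] with i h1 h3
    exact h1.trans_le h3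
  obtain ⟨G, hG⟩ := WellFoundedLT.exists_rec (W := W) _ step
  choose hG₁ a₀ ha₀ using hG
  obtain ⟨a, ha⟩ := hΛ a₀ (hW.le.trans (Order.succ_le_of_lt ((cantor θ).trans_le h2)))
  have hex : ∀ ζ : W, ∃ i, f a i ≤ G ζ i ∧
      G ζ i < k ζ (fun ξ => G ξ) (τ ζ (fun ξ => G ξ) a i) i := fun ζ =>
    ((hG₁ ζ a).and (ha₀ ζ a (ha ζ).le)).exists
  choose I hI₁ hI₂ using hex
  have : Infinite W := by
    rw [infinite_iff, hW]
    exact hθ.trans (Order.le_succ θ)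
  obtain ⟨i, hi⟩ := exists_infinite_fiber I (by rw [hW]; exact Order.lt_succ_of_le hι)
  obtain ⟨s, hs | hs⟩ := Infinite.exists_strictMono_or_strictAnti (I ⁻¹' {i})
  -- At index `i`, each later cover may use an earlier `G ξ` as a candidate, and `G ξ` is already
  -- below the cover of stage `ξ`. So the covers descend strictly.
  · refine not_strictAnti_of_wellFoundedLT
      (fun n => k (s n).1 (fun ξ => G ξ) (τ (s n).1 (fun ξ => G ξ) a i) i) fun m n hmn => ?_
    have hm : I (s m) = i := (s m).2
    have h1 := hI₁ (s m)
    have h3 := hI₂ (s m)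
    rw [hm] at h1 h3
    exact (hτmin (s n).1 (fun ξ => G ξ) a i (some ⟨(s m).1, hs hmn⟩) h1).trans_lt h3
  · exact not_strictAnti_of_wellFoundedLT s hs

variable [WellFoundedLT Λ]

/-- The product of the successors of cofinally many cardinals below `ν` is `ν⁺`-directed. -/
theorem exists_increasing_sequence (hIio : ∀ a : Λ, #(Set.Iio a) ≤ ν) {N : ι → Cardinal.{u}}
    (hN : ∀ i, ℵ₀ ≤ N i) (hcof : ∀ c < ν, ∀ᶠ i in D, c < N i) :
    ∃ f : Λ → ι → Ordinal.{u}, (∀ a i, f a i < (Order.succ (N i)).ord) ∧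
      ∀ a b, a < b → ∀ᶠ i in D, f a i < f b i := by
  have step : ∀ (a : Λ) (g : {b // b < a} → ∀ i, Set.Iio (Order.succ (N i)).ord),
      ∃ y : ∀ i, Set.Iio (Order.succ (N i)).ord, ∀ b, ∀ᶠ i in D, (g b i).1 < (y i).1 := by
    intro a g
    have hT : #{b // b < a} ≤ #ν.ord.ToType := by
      rw [mk_toType, card_ord]
      exact hIio a
    obtain ⟨k⟩ := (le_def _ _).1 hT
    -- At `i` only the `b` enumerated before `(N i).ord` are bounded; each `b` is among them for
    -- almost all `i`.
    have : ∀ i, ∃ o < (Order.succ (N i)).ord,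
        ∀ b : {b // Ordinal.ToType.toOrd (k b) < (N i).ord}, (g b i : Ordinal) < o := fun i => by
      refine (isRegular_succ (hN i)).exists_bound ?_ _ fun b => (g b i).2
      have := lift_mk_le_lift_mk_of_injective (α := {b // Ordinal.ToType.toOrd (k b) < (N i).ord})
        (β := Set.Iio (N i).ord) (f := fun b => ⟨Ordinal.ToType.toOrd (k b.1), b.2⟩)
        fun b c h => by
          have := congrArg Subtype.val h
          exact Subtype.ext (k.injective (Ordinal.ToType.mk.symm.injective (Subtype.ext this)))
      rw [mk_Iio_ordinal, card_ord, lift_lift, lift_le.{max u (u + 1)}] at this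
      simpa using this
    choose o ho h using this
    refine ⟨fun i => ⟨o i, ho i⟩, fun b => ?_⟩
    refine (hcof (Ordinal.ToType.toOrd (k b)).1.card (lt_ord.1 (Ordinal.ToType.toOrd (k b)).2)).mono
      fun i hi => ?_
    exact h i ⟨b, lt_ord.2 hi⟩
  obtain ⟨F, hF⟩ := WellFoundedLT.exists_rec _ step
  exact ⟨fun a i => F a i, fun a i => (F a i).2, fun a b hab => hF b ⟨a, hab⟩⟩

theorem Ordinal.exists_cofinal_map (o : Ordinal.{u}) : ∃ e : Ordinal.{u} → Ordinal.{u},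
    (∀ x < o.cof.ord, e x < o) ∧ (∀ x y, x ≤ y → y < o.cof.ord → e x ≤ e y) ∧
      ∀ y < o, ∃ x < o.cof.ord, y ≤ e x := by
  classical
  obtain ⟨f, hf⟩ := Ordinal.exists_isFundamentalSeq (o := o) rfl
  refine ⟨fun x => if h : x ∈ Set.Iio o.cof.ord then f ⟨x, h⟩ else 0, fun x hx => ?_,
    fun x y hxy hy => ?_, fun y hy => ?_⟩
  · dsimp only
    rw [dif_pos (Set.mem_Iio.2 hx)]
    exact (f ⟨x, hx⟩).2
  · dsimp only
    rw [dif_pos (Set.mem_Iio.2 hy), dif_pos (Set.mem_Iio.2 (hxy.trans_lt hy))]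
    exact hf.strictMono.monotone hxy
  · obtain ⟨_, ⟨⟨x, hx⟩, rfl⟩, h⟩ := hf.isCofinal_range ⟨y, hy⟩
    refine ⟨x, hx, ?_⟩
    dsimp only
    rw [dif_pos hx]
    exact h

end Scale

section Scale

variable {Λ : Type u} [LinearOrder Λ] [WellFoundedLT Λ] {ι : Type u} {D : Ultrafilter ι}
  {ν θ : Cardinal.{u}}

/-- Below a strong limit cardinal, there is a function into the ordinals, with large regular
cofinalities, which is the limit of a sequence of length `ν⁺` modulo an ultrafilter. -/
theorem exists_exact_upper_bound
    (hΛ : ∀ {T : Type u} (t : T → Λ), #T ≤ ν → ∃ a, ∀ x, t x < a)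
    (hIio : ∀ a : Λ, #(Set.Iio a) ≤ ν) (hθ : ℵ₀ ≤ θ) (hθν : θ < ν) (hι : #ι ≤ θ)
    (hν : ν.IsStrongLimit) {N : ι → Cardinal.{u}}
    (hN : ∀ i, ℵ₀ ≤ N i) (hNν : ∀ i, N i < ν) (hcof : ∀ c < ν, ∀ᶠ i in D, c < N i) :
    ∃ (f : Λ → ι → Ordinal.{u}) (h : ι → Ordinal.{u}), (∀ a, ∀ᶠ i in D, f a i < h i) ∧
      (∀ y : ι → Ordinal.{u}, (∀ᶠ i in D, y i < h i) → ∃ a₀, ∀ a, a₀ ≤ a →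
        ∀ᶠ i in D, y i < f a i) ∧
      (∀ c < ν, ∀ᶠ i in D, c < (h i).cof) ∧ ∀ᶠ i in D, (h i).cof < ν := by
  classical
  have hpow : ∀ c < ν, c ^ θ < ν := fun c hc => by
    refine (power_le_power_right (cantor c).le).trans_lt ?_
    rw [← power_mul]
    exact hν.isStrongPrelimit (mul_lt_of_lt (hθ.trans hθν.le) hc hθν)
  obtain ⟨f, hf, hinc⟩ := exists_increasing_sequence (Λ := Λ) hIio hN hcof
  have hle : ∀ a b, a ≤ b → ∀ᶠ i in D, f a i ≤ f b i := fun a b hab => by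
    rcases hab.lt_or_eq with hab | rfl
    · exact (hinc a b hab).mono fun i hi => hi.le
    · exact .of_forall fun i => le_rfl
  obtain ⟨h, hub, hleast⟩ := exists_least_upper_bound hΛ hθ hι (hν.isStrongPrelimit hθν).le f hle
    (fun i => (Order.succ (N i)).ord) fun a i => (hf a i).le
  have hlt : ∀ a, ∀ᶠ i in D, f a i < h i := fun a => by
    obtain ⟨b, hb⟩ := hΛ (fun _ : PUnit => a)
      (by simpa using (one_lt_aleph0.trans_le (hθ.trans hθν.le)).le)
    filter_upwards [hinc a b (hb ⟨⟩), hub b] with i h1 h2 using h1.trans_le h2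
  -- The order modulo an ultrafilter is linear, so a least upper bound is exact.
  have hlim : ∀ y : ι → Ordinal.{u}, (∀ᶠ i in D, y i < h i) → ∃ a₀, ∀ a, a₀ ≤ a →
        ∀ᶠ i in D, y i < f a i := fun y hy => by
    by_contra! H
    have : ∀ᶠ i in D, h i ≤ y i := hleast y fun a => by
      obtain ⟨b, hab, hb⟩ := H a
      filter_upwards [hle a b hab, hb] with i h1 h2 using h1.trans h2
    obtain ⟨i, h1, h2⟩ := (this.and hy).exists
    exact h1.not_gt h2
  refine ⟨f, h, hlt, hlim, fun c hc => ?_, ?_⟩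
  -- If the cofinalities were at most `c` almost everywhere, one `f a` would exceed all of the at
  -- most `ν` functions that select points of the cofinal sequences; yet some such function is at
  -- least `f a`.
  · by_contra! hcof'
    choose e he _ hecof using fun i => Ordinal.exists_cofinal_map (h i)
    have hlt' : ∀ z : ι → c.ord.ToType, ∀ᶠ i in D,
        (if (Ordinal.ToType.toOrd (z i)).1 < (h i).cof.ord then
          e i (Ordinal.ToType.toOrd (z i)) else 0) < h i := fun z => by
      obtain ⟨a, -⟩ := hΛ (T := PEmpty) (fun x => x.elim) (by simp)
      refine (hlt a).mono fun i hi => ?_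
      split_ifs with hz
      · exact he i _ hz
      · exact bot_le.trans_lt hi
    choose a₀ ha₀ using fun z => hlim _ (hlt' z)
    obtain ⟨a, ha⟩ := hΛ a₀ (by
      rw [← power_def, mk_toType, card_ord]
      rcases eq_or_ne c 0 with rfl | hc0
      · exact (zero_power_le _).trans (one_lt_aleph0.trans_le (hθ.trans hθν.le)).le
      · exact (power_le_power_left hc0 hι).trans (hpow c hc).le)
    have hz : ∀ i, ∃ z : c.ord.ToType, f a i < h i → (h i).cof ≤ c →
        (Ordinal.ToType.toOrd z).1 < (h i).cof.ord ∧ f a i ≤ e i (Ordinal.ToType.toOrd z) := by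
      intro i
      by_cases hi : f a i < h i ∧ (h i).cof ≤ c
      · obtain ⟨x, hx, hxe⟩ := hecof i _ hi.1
        refine ⟨Ordinal.ToType.mk ⟨x, hx.trans_le (ord_le_ord.2 hi.2)⟩, fun _ _ => ?_⟩
        simpa using ⟨hx, hxe⟩
      · have : c ≠ 0 := by
          rintro rfl
          obtain ⟨i, h1, h2⟩ := (hcof'.and (hlt a)).exists
          have : h i = 0 := by simpa using h1
          simp [this] at h2
        have : Nonempty c.ord.ToType := by
          rw [← mk_ne_zero_iff]
          simpa
        exact ⟨Classical.arbitrary _, fun h1 h2 => (hi ⟨h1, h2⟩).elim⟩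
    choose z hz using hz
    obtain ⟨i, ⟨h1, h2⟩, h3⟩ := ((hlt a).and hcof' |>.and (ha₀ z a (ha z).le)).exists
    obtain ⟨h4, h5⟩ := hz i h1 h2
    rw [if_pos h4] at h3
    exact h5.not_gt h3
  · refine (hleast (fun i => (Order.succ (N i)).ord) fun a =>
      .of_forall fun i => (hf a i).le).mono fun i hi => ?_
    refine (Ordinal.cof_le_card _).trans_lt ?_
    refine lt_of_le_of_lt ?_ (hν.isSuccLimit.succ_lt (hNν i))
    simpa using Ordinal.card_le_card hi

/-- The regular cardinals between `θ` and `ν`. -/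
abbrev RegularBetween (θ ν : Cardinal.{u}) : Type (u + 1) :=
  {κ : Cardinal.{u} // κ.IsRegular ∧ θ < κ ∧ κ < ν}

/-- Below a strong limit cardinal `ν`, there is an ultrafilter modulo which a sequence of length `ν⁺`
dominates the product of the regular cardinals. -/
theorem exists_dominating_sequence
    (hΛ : ∀ {T : Type u} (t : T → Λ), #T ≤ ν → ∃ a, ∀ x, t x < a)
    (hIio : ∀ a : Λ, #(Set.Iio a) ≤ ν) (hθ : ℵ₀ ≤ θ) (hθν : θ < ν) (hι : #ι ≤ θ)
    (hν : ν.IsStrongLimit) {N : ι → Cardinal.{u}}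
    (hN : ∀ i, ℵ₀ ≤ N i) (hNν : ∀ i, N i < ν) (hcof : ∀ c < ν, ∀ᶠ i in D, c < N i) :
    ∃ (E : Ultrafilter (RegularBetween θ ν)) (H : Λ → RegularBetween θ ν → Ordinal.{u}),
      (∀ a r, H a r < r.1.ord) ∧ (∀ c < ν, ∀ᶠ r in (E : Filter (RegularBetween θ ν)), c < r.1) ∧
      ∀ g : RegularBetween θ ν → Ordinal.{u}, (∀ r, g r < r.1.ord) →
        ∃ a₀, ∀ a, a₀ ≤ a → ∀ᶠ r in E, g r < H a r := by
  classical
  obtain ⟨f, h, hlt, hlim, hbig, hsmall⟩ :=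
    exists_exact_upper_bound (Λ := Λ) hΛ hIio hθ hθν hι hν hN hNν hcof
  choose e he hemono hecof using fun i => Ordinal.exists_cofinal_map (h i)
  have hgood : ∀ᶠ i in D, (h i).cof.IsRegular ∧ θ < (h i).cof ∧ (h i).cof < ν := by
    filter_upwards [hbig θ hθν, hsmall] with i h1 h2
    refine ⟨isRegular_cof ?_, h1, h2⟩
    rw [← Ordinal.one_lt_cof_iff]
    exact (one_lt_aleph0.trans_le hθ).trans h1
  obtain ⟨i₀, hi₀⟩ := hgood.exists
  let π : ι → RegularBetween θ ν := fun i => if hi : _ then ⟨(h i).cof, hi⟩ else ⟨(h i₀).cof, hi₀⟩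
  have hπ : ∀ᶠ i in D, (π i).1 = (h i).cof := hgood.mono fun i hi => by simp [π, hi]
  -- `π` may identify indices; as `#ι ≤ θ < r`, one ordinal below `r` serves them all.
  have hH : ∀ a (r : RegularBetween θ ν), ∃ o < r.1.ord, ∀ i, r.1 = (h i).cof → f a i < h i →
      ∃ x < o, f a i ≤ e i x := by
    intro a r
    have : ∀ i, ∃ x < r.1.ord, r.1 = (h i).cof → f a i < h i → f a i ≤ e i x := by
      intro i
      by_cases hi : r.1 = (h i).cof ∧ f a i < h i
      · obtain ⟨x, hx, hxe⟩ := hecof i _ hi.2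
        exact ⟨x, hi.1 ▸ hx, fun _ _ => hxe⟩
      · exact ⟨0, r.2.1.ord_pos, fun h1 h2 => (hi ⟨h1, h2⟩).elim⟩
    choose x hx hxe using this
    obtain ⟨o, ho, hxo⟩ := r.2.1.exists_bound (lift_lt.2 (hι.trans_lt r.2.2.1)) x hx
    exact ⟨o, ho, fun i h1 h2 => ⟨x i, hxo i, hxe i h1 h2⟩⟩
  choose H hHlt hH using hH
  refine ⟨D.map π, H, hHlt, fun c hc => ?_, fun g hg => ?_⟩
  · rw [Ultrafilter.coe_map, Filter.eventually_map]
    filter_upwards [hbig c hc, hπ] with i h1 h2 using h2 ▸ h1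
  · obtain ⟨a₀, ha₀⟩ := hlim (fun i => e i (g (π i))) (hπ.mono fun i hi => he i _ (hi ▸ hg (π i)))
    refine ⟨a₀, fun a ha => ?_⟩
    rw [Ultrafilter.coe_map, Filter.eventually_map]
    filter_upwards [ha₀ a ha, hπ, hlt a] with i h1 h2 h3
    obtain ⟨x, hx, hxe⟩ := hH a (π i) i h2 h3
    by_contra! hle
    exact (hxe.trans (hemono i _ _ (hx.le.trans hle) (h2 ▸ hg (π i)))).not_gt h1

/-- A dominating sequence can be thinned out so that its gaps exceed a given function. -/
theorem exists_scale (hΛ : ∀ {T : Type u} (t : T → Λ), #T ≤ ν → ∃ a, ∀ x, t x < a)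
    (hIio : ∀ a : Λ, #(Set.Iio a) ≤ ν) {J : Type w} {E : Filter J} {κ : J → Cardinal.{u}}
    (hκ : ∀ r, ℵ₀ ≤ κ r) (H : Λ → J → Ordinal.{u}) (hH : ∀ a r, H a r < (κ r).ord)
    (hdom : ∀ g : J → Ordinal.{u}, (∀ r, g r < (κ r).ord) →
      ∃ a₀, ∀ a, a₀ ≤ a → ∀ᶠ r in E, g r < H a r)
    (b : J → Ordinal.{u}) (hb : ∀ r, b r < (κ r).ord) :
    ∃ F : Λ → J → Ordinal.{u}, (∀ a r, F a r < (κ r).ord) ∧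
      (∀ a a', a < a' → ∀ᶠ r in E, F a r + b r ≤ F a' r) ∧
      ∀ g : J → Ordinal.{u}, (∀ r, g r < (κ r).ord) → ∃ a, ∀ᶠ r in E, g r ≤ F a r := by
  -- The clause `a ≤ y` keeps the thinned sequence dominating.
  have step : ∀ (a : Λ) (s : {c // c < a} → Λ), ∃ y, a ≤ y ∧
      ∀ c, ∀ᶠ r in E, H (s c) r + b r ≤ H y r := by
    intro a s
    choose a₀ ha₀ using fun c => hdom (fun r => H (s c) r + b r)
      fun r => Ordinal.isPrincipal_add_ord (hκ r) (hH (s c) r) (hb r)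
    obtain ⟨y, hy⟩ := hΛ a₀ (hIio a)
    exact ⟨max a y, le_max_left _ _, fun c =>
      (ha₀ c _ ((hy c).le.trans (le_max_right _ _))).mono fun r hr => hr.le⟩
  obtain ⟨A, hA⟩ := WellFoundedLT.exists_rec _ step
  refine ⟨fun a => H (A a), fun a r => hH _ r, fun a a' haa => (hA a').2 ⟨a, haa⟩, fun g hg => ?_⟩
  obtain ⟨a, ha⟩ := hdom g hg
  exact ⟨a, (ha _ (hA a).1).mono fun r hr => hr.le⟩

end Scale

/-! ### The strong limit case and the conclusion. -/

theorem Cardinal.IsSingular.exists_cofinal_family {ν : Cardinal.{u}} (hν : ν.IsSingular)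
    {χ : Cardinal.{u}} (hχ : χ < ν) : ∃ (ι : Type u) (N : ι → Cardinal.{u}),
      #ι ≤ ν.ord.cof ∧ Function.Injective N ∧ (∀ i, χ < N i) ∧ (∀ i, N i < ν) ∧
      ∀ c < ν, ∃ i, c < N i := by
  obtain ⟨S, hS, hcard⟩ := Order.exists_cof_eq ν.ord.ToType
  rw [Ordinal.cof_toType] at hcard
  let M : ν.ord.ToType → Cardinal.{u} := fun s =>
    Order.succ (max χ (Ordinal.ToType.toOrd s).1.card)
  obtain ⟨T, hTS, hT⟩ := (Set.surjOn_image M S).exists_bijOn_subset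
  refine ⟨T, fun i => M i, (mk_le_mk_of_subset hTS).trans hcard.le,
    fun x y h => Subtype.ext (hT.injOn x.2 y.2 h), fun i => Order.lt_succ_of_le (le_max_left _ _),
    fun i => hν.isSuccLimit.succ_lt (max_lt hχ (lt_ord.1 (Ordinal.ToType.toOrd i.1).2)),
    fun c hc => ?_⟩
  obtain ⟨s, hs, hcs⟩ := hS (Ordinal.ToType.mk ⟨c.ord, ord_lt_ord.2 hc⟩)
  obtain ⟨t, ht, hts⟩ := hT.surjOn (Set.mem_image_of_mem M hs)
  refine ⟨⟨t, ht⟩, ?_⟩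
  change c < M t
  rw [hts]
  refine Order.lt_succ_of_le (le_max_of_le_right ?_)
  rw [← ord_le]
  exact Ordinal.ToType.mk.le_symm_apply.2 hcs

theorem Cardinal.exists_ultrafilter_tails {ν : Cardinal.{u}} (hν : Order.IsSuccLimit ν)
    {ι : Type u} {N : ι → Cardinal.{u}} (hNν : ∀ i, N i < ν) (hcof : ∀ c < ν, ∃ i, c < N i) :
    ∃ D : Ultrafilter ι, ∀ c < ν, ∀ᶠ i in D, c < N i := by
  let M : ι → Set.Iio ν := fun i => ⟨N i, hNν i⟩
  have : Nonempty (Set.Iio ν) := ⟨⟨0, bot_le.lt_of_ne hν.ne_bot.symm⟩⟩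
  have : (Filter.comap M Filter.atTop).NeBot := by
    rw [Filter.comap_neBot_iff]
    intro t ht
    obtain ⟨c, hc⟩ := Filter.mem_atTop_sets.1 ht
    obtain ⟨i, hi⟩ := hcof c.1 c.2
    exact ⟨i, hc _ hi.le⟩
  refine ⟨Ultrafilter.of (Filter.comap M Filter.atTop), fun c hc => Ultrafilter.of_le _ ?_⟩
  refine ((Filter.eventually_ge_atTop (⟨Order.succ c, hν.succ_lt hc⟩ : Set.Iio ν)).comap M).mono
    fun i hi => ?_
  exact (Order.lt_succ c).trans_le hi

/-- If `ν` is a strong limit, then the sequences at the regular coordinates are read along a scale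
of length `ν⁺`. -/
theorem addsGeneric_of_isStrongLimit {ν : Cardinal.{u}} (hν : ν.IsSingular) (hs : ν.IsStrongLimit)
    {I : Type v} {K : I → Cardinal.{u}} (idx : RegularBetween ν.ord.cof ν → I)
    (hidx : ∀ r, K (idx r) = r.1) :
    AddsGeneric (∀ i, CohenCond (K i)) (CohenCond (Order.succ ν)) := by
  have inj : Function.Injective idx := fun r s h => Subtype.ext (by rw [← hidx, h, hidx])
  have hθ : ℵ₀ ≤ ν.ord.cof := by
    rw [Ordinal.aleph0_le_cof_iff, Ordinal.one_lt_cof_iff]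
    exact isSuccLimit_ord hν.aleph0_le
  obtain ⟨ι, N, hι, -, hN, hNν, hcof⟩ :=
    hν.exists_cofinal_family (χ := ℵ₀) (hθ.trans_lt hν.cof_ord_lt)
  obtain ⟨D, hD⟩ := exists_ultrafilter_tails hs.isSuccLimit hNν hcof
  let Λ := (Order.succ ν).ord.ToType
  have hΛ : ∀ {T : Type u} (t : T → Λ), #T ≤ ν → ∃ a, ∀ x, t x < a := by
    intro T t hT
    obtain ⟨o, ho, h⟩ := (isRegular_succ hν.aleph0_le).exists_bound
      (lift_lt.2 (Order.lt_succ_of_le hT)) (fun x => (Ordinal.ToType.toOrd (t x)).1)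
      fun x => (Ordinal.ToType.toOrd (t x)).2
    exact ⟨Ordinal.ToType.mk ⟨o, ho⟩, fun x => Ordinal.ToType.mk.symm_apply_lt.1 (h x)⟩
  have hIio : ∀ a : Λ, #(Set.Iio a) ≤ ν := fun a => by
    have := mk_Iio_lt a (by simp [Λ])
    rw [mk_toType, card_ord] at this
    exact Order.lt_succ_iff.1 this
  obtain ⟨E, H, hH, hE, hdom⟩ := exists_dominating_sequence (D := D) hΛ hIio hθ hν.cof_ord_lt hι hs
    (fun i => (hN i).le) hNν hD
  -- The blocks at `r` are shorter than `r` but exceed every `N i < r`, so along `E` their lengths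
  -- pass every ordinal below `ν`.
  have hb : ∀ r : RegularBetween ν.ord.cof ν, ∃ o < r.1.ord, ∀ i : {i // N i < r.1},
      (N i).ord < o := fun r =>
    r.2.1.exists_bound (lift_lt.2 (((mk_subtype_le _).trans hι).trans_lt r.2.2.1)) _
      fun i => ord_lt_ord.2 i.2
  choose b hb hNb using hb
  have hb' : ∀ j < ν.ord, ∃ᶠ r in (E : Filter (RegularBetween ν.ord.cof ν)), j < b r :=
      fun j hj => by
    obtain ⟨i, hi⟩ := hcof j.card (lt_ord.1 hj)
    exact ((hE (N i) (hNν i)).mono fun r hr => (lt_ord.2 hi).trans (hNb r ⟨i, hr⟩)).frequently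
  obtain ⟨F, hF, hFb, hFdom⟩ := exists_scale (E := E) (κ := fun r => r.1) hΛ hIio
    (fun r => r.2.1.aleph0_le) H hH hdom b hb
  obtain ⟨e, he⟩ := exists_code (CohenCond.mk_le hν.aleph0_le)
  refine Forcing.addsGeneric_of_sequence (A := Λ)
    (decided := fun p => {a | Full (E : Filter (RegularBetween ν.ord.cof ν)) idx b (F a) p})
    (c := fun p a => readCode (E : Filter (RegularBetween ν.ord.cof ν)) idx e b (F a) p) ?_
    (fun hp _ ha => Full.mono ha hp) (fun hp ha => Full.readCode_eq ha hp)
    (CohenCond.chain hν.aleph0_le fun a => lift_le.2 (hIio a)) ?_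
  · intro p a a' haa ha
    rcases haa.lt_or_eq with haa | rfl
    · filter_upwards [ha, hFb a' a haa] with r h1 h2
      exact h2.trans (le_self_add.trans h1)
    · exact ha
  · intro p
    -- Block `a` starts beyond `p` at almost all `r`; padding up to `F a` completes all earlier
    -- blocks.
    obtain ⟨a, ha⟩ := hFdom (fun r => (p (idx r)).len) fun r => hidx r ▸ (p (idx r)).len_lt
    obtain ⟨p₁, hp₁, hlen, -, -⟩ := exists_extension_pi inj p (F a)
      (fun r => by rw [hidx]; exact hF a r) (fun _ _ => false)
    refine ⟨p₁, hp₁, a, fun a' haa => (hFb a' a haa).mono fun r hr => ?_, fun x => ?_⟩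
    · rw [hlen]
      exact le_max_of_le_right hr
    · obtain ⟨p₂, hp₂, hfull, hcodes, -⟩ := exists_codes (l := E) (e := e) (b := b) (f := F a) inj
        p₁ (fun r => by
          rw [hidx]
          exact Ordinal.isPrincipal_add_ord r.2.1.aleph0_le (hF a r) (hb r))
        (ha.mono fun r hr => by rw [hlen, max_eq_right hr]) x
      exact ⟨p₂, hp₂, hfull, hcodes.readCode_eq he hb'⟩

/-- A product of Cohen forcing notions in which all regular cardinals below the singular cardinal
`ν` occur adds a generic for the Cohen forcing notion on `ν⁺`. -/
theorem addsGeneric_of_isSingular {ν : Cardinal.{u}} (hν : ν.IsSingular) {I : Type v}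
    (K : I → Cardinal.{u}) (hK : ∀ κ : Cardinal.{u}, κ.IsRegular → κ < ν → ∃ i, K i = κ) :
    AddsGeneric (∀ i, CohenCond (K i)) (CohenCond (Order.succ ν)) := by
  by_cases hs : ∀ c < ν, 2 ^ c < ν
  · choose idx hidx using fun r : RegularBetween ν.ord.cof ν => hK r.1 r.2.1 r.2.2.2
    exact addsGeneric_of_isStrongLimit hν ⟨hν.pos.ne', fun c hc => hs c hc⟩ idx hidx
  · push Not at hs
    obtain ⟨c, hc, h2⟩ := hs
    have hθ : ℵ₀ ≤ ν.ord.cof := by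
      rw [Ordinal.aleph0_le_cof_iff, Ordinal.one_lt_cof_iff]
      exact isSuccLimit_ord hν.aleph0_le
    -- Enlarging `c` to at least the cofinality lets a cofinal family have at most `χ` members.
    have hχ : ℵ₀ ≤ max c ν.ord.cof := le_max_of_le_right hθ
    have hχν : max c ν.ord.cof < ν := max_lt hc hν.cof_ord_lt
    obtain ⟨ι, N, hι, inj, hN, hNν, hcof⟩ := hν.exists_cofinal_family hχν
    obtain ⟨i₀, hi₀⟩ := hK _ (isRegular_succ hχ) (hν.isSuccLimit.succ_lt hχν)
    choose idx hidx using fun i => hK (Order.succ (N i)) (isRegular_succ (hχ.trans (hN i).le))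
      (hν.isSuccLimit.succ_lt (hNν i))
    refine addsGeneric_of_le_two_power hχ hχν
      (h2.trans (power_le_power_left two_ne_zero (le_max_left _ _))) hi₀
      (hι.trans (le_max_right _ _)) hN hNν hcof (idx := idx) (fun i j h => inj ?_) hidx
    exact Order.succ_injective (by rw [← hidx, h, hidx])

theorem mainTheorem2 :
    (∀ ν : Cardinal.{u}, ν.IsSingular →
      AddsGeneric (∀ κ : {κ : Cardinal.{u} // Cardinal.aleph0 ≤ κ ∧ κ < ν}, CohenCond κ.1)
          (CohenCond (Order.succ ν)) ∧
      AddsGeneric (∀ κ : {κ : Cardinal.{u} // κ.IsRegular ∧ κ < ν}, CohenCond κ.1)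
          (CohenCond (Order.succ ν))) ∧
    AddsGeneric (∀ n : ℕ, CohenCond (Cardinal.aleph.{u} (n : Ordinal.{u})))
      (CohenCond (Cardinal.aleph.{u} (Ordinal.omega0 + 1))) := by
  refine ⟨fun ν hν => ⟨?_, ?_⟩, ?_⟩
  · exact addsGeneric_of_isSingular hν _ fun κ hκ hκν => ⟨⟨κ, hκ.aleph0_le, hκν⟩, rfl⟩
  · exact addsGeneric_of_isSingular hν _ fun κ hκ hκν => ⟨⟨κ, hκ, hκν⟩, rfl⟩
  · rw [← succ_aleph]
    refine addsGeneric_of_isSingular isSingular_aleph_omega0 _ fun κ hκ hκν => ?_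
    obtain ⟨o, rfl⟩ := mem_range_aleph_iff.2 hκ.aleph0_le
    obtain ⟨n, rfl⟩ := Ordinal.lt_omega0.1 (aleph_lt_aleph.1 hκν)
    exact ⟨n, rfl⟩
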